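/- Let $n\ge 3$, $1\le s\le n$, $R\ge 0$, $\alpha_2>0$, $\beta_1\ge 0$, and let $\mathcal B_1(R)=\{x\in\mathbb R^n:\|x\|_1\le R\}$. Let $f:\mathbb R^n\to\mathbb R$ be convex on $\mathcal B_1(R)$ and differentiable at every point of $\mathcal B_1(R)$ (for instance, convex and continuously differentiable on $\mathbb R^n$), with $\|\nabla f(x)-\nabla f(y)\|_\infty\le\beta_1\|x-y\|_1$ for all $x,y\in\mathcal B_1(R)$. Assume that the problem $\min_{\|x\|_1\le R}f(x)$ has a unique optimal solution $x^*$, that $x^*$ has at most $s$ non-zero entries, and that the quadratic growth condition $\|x-x^*\|_2^2\le\frac{2}{\alpha_2}(f(x)-f(x^*))$ holds for all $x\in\mathcal B_1(R)$. *Inner method.* Given $\bar x\in\mathcal B_1(R)$, let $p=1+1/\ln n$ and $d(z)=\frac12 e\ln(n)\,n^{(p-1)(2-p)/p}\|z-\bar x\|_p^2$, put $u_0=\bar x$, and for $k=0,1,\dots$ take $$y_k\in\arg\min_{y\in\mathcal B_1(R)}\Big\{\langle y-u_k,\nabla f(u_k)\rangle+\tfrac{\beta_1}{2}\|y-u_k\|_1^2\Big\},$$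 $$z_k\in\arg\min_{z\in\mathcal B_1(R)}\Big\{\beta_1 d(z)+\sum_{i=0}^k\tfrac{i+1}{2}\langle z-u_i,\nabla f(u_i)\rangle\Big\},$$ $$u_{k+1}=\tfrac{2}{k+3}z_k+\tfrac{k+1}{k+3}y_k .$$ *Restarted method with epoch length $K\in\mathbb N$.* Start from any $x_0\in\mathcal B_1(R)$ with at most $s$ non-zero entries. For $t=0,1,\dots$ let $\widehat x_t$ be a Euclidean projection of $x_t$ onto the set of vectors with at most $s$ non-zero entries (hard-thresholding), and let $x_{t+1}$ be the point $y_K$ produced by the inner method started at $\bar x=\widehat x_t$. Iteration $k$ of an epoch makes one call to the first-order oracle of $f$, at $u_k$, so that an epoch makes $K+1$ calls. 1. If $K\ge\sqrt{64\,s\,\beta_1e^2\ln(n)/\alpha_2}-1$, then every run of the restarted method satisfies $$f(x_{t+1})-f(x^*)\le\frac{\alpha_2R^2}{s}\,2^{-(t+3)}\qquad\text{for all }t\ge 0 .$$ 2. There is a universal constant $C>0$ such that the following holds. Let $\varepsilon>0$ and let $K$ be the least natural number satisfying the condition in 1. Then there is a number of epochs $T$, depending only on $n,s,R,\alpha_2,\beta_1,\varepsilon$,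 such that in every run $f(x_t)-f(x^*)\le\varepsilon$ for all $t\ge T$, and the first $T$ epochs make at most $$C\,\max\Big\{1,\sqrt{\tfrac{\beta_1 s\ln n}{\alpha_2}}\Big\}\,\max\Big\{1,\ln\tfrac{\alpha_2R^2}{s\varepsilon}\Big\}$$ calls to the first-order oracle of $f$ (with the logarithm read as $0$ if $R=0$). -/

import Mathlib

open scoped RealInnerProductSpace

noncomputable section

namespace SparseL1

/-- Points of `ℝⁿ`; the norm of this type is the Euclidean norm. -/
abbrev Vec (n : ℕ) := EuclideanSpace ℝ (Fin n)

/-- The `ℓ₁` norm. -/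
def l1Norm {n : ℕ} (x : Vec n) : ℝ := ∑ i, |x i|

/-- The `ℓ_p` norm, for real `p ≥ 1`. -/
def lpNorm {n : ℕ} (p : ℝ) (x : Vec n) : ℝ := (∑ i, |x i| ^ p) ^ (1 / p)

/-- The `ℓ_∞` norm (dual to `ℓ₁`): the norm of `Fin n → ℝ` in Mathlib is the maximum norm. -/
def linfNorm {n : ℕ} (x : Vec n) : ℝ := ‖x.ofLp‖

/-- The number of non-zero entries. -/
def nnz {n : ℕ} (x : Vec n) : ℕ := hammingNorm x.ofLp

/-- The origin-centred `ℓ₁` ball of radius `R`. -/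
def l1Ball (n : ℕ) (R : ℝ) : Set (Vec n) := {x | l1Norm x ≤ R}

/-- `a` is one of the minimizers of `φ` over the set `S`. -/
def IsArgmin {n : ℕ} (φ : Vec n → ℝ) (S : Set (Vec n)) (a : Vec n) : Prop :=
  a ∈ S ∧ IsMinOn φ S a

/-- The set of optimal solutions of `min f(x)` subject to `‖x‖₁ ≤ R`. -/
def optSet {n : ℕ} (f : Vec n → ℝ) (R : ℝ) : Set (Vec n) := {x | IsArgmin f (l1Ball n R) x}

/-- The gradient of `f` is `β`-Lipschitz over the ball with respect to the `ℓ₁` norm. -/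
def L1Smooth {n : ℕ} (f : Vec n → ℝ) (R β : ℝ) : Prop :=
  ∀ x ∈ l1Ball n R, ∀ y ∈ l1Ball n R,
    linfNorm (gradient f x - gradient f y) ≤ β * l1Norm (x - y)

/-- Quadratic growth over the ball with constant `α` with respect to the Euclidean norm. -/
def QuadraticGrowth {n : ℕ} (f : Vec n → ℝ) (R α : ℝ) : Prop :=
  ∀ x ∈ l1Ball n R, ∃ w ∈ optSet f R, ‖x - w‖ ^ 2 ≤ 2 / α * (f x - f w)

/-- The assumptions on the problem `min f(x)` subject to `‖x‖₁ ≤ R`. -/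
structure IsProblem {n : ℕ} (f : Vec n → ℝ) (R α β : ℝ) (s : ℕ) (xstar : Vec n) : Prop where
  convex : ConvexOn ℝ (l1Ball n R) f
  differentiable : ∀ x ∈ l1Ball n R, DifferentiableAt ℝ f x
  smooth : L1Smooth f R β
  growth : QuadraticGrowth f R α
  unique_opt : optSet f R = {xstar}
  sparse_opt : nnz xstar ≤ s

/-- The exponent `p = 1 + 1 / ln n`. -/
def proxExponent (n : ℕ) : ℝ := 1 + 1 / Real.log n

/-- The prox function
`d(z) = (1/2) e ln(n) n^((p-1)(2-p)/p) ‖z - x₀‖_p²` centred at `x₀`. -/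
def prox {n : ℕ} (x₀ z : Vec n) : ℝ :=
  1 / 2 * Real.exp 1 * Real.log n *
    (n : ℝ) ^ ((proxExponent n - 1) * (2 - proxExponent n) / proxExponent n) *
    lpNorm (proxExponent n) (z - x₀) ^ 2

/-- Iterations `k = 0, …, K` of Nesterov's accelerated method over the `ℓ₁` ball (with `σ = 1`)
started at `x₀`. Every choice among several minimizers is allowed. -/
structure IsAccRun {n : ℕ} (f : Vec n → ℝ) (R β : ℝ) (K : ℕ) (x₀ : Vec n)
    (x y z : ℕ → Vec n) : Prop where
  init : x 0 = x₀
  y_step : ∀ k ≤ K, IsArgmin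
    (fun v => ⟪v - x k, gradient f (x k)⟫ + β / 2 * l1Norm (v - x k) ^ 2) (l1Ball n R) (y k)
  z_step : ∀ k ≤ K, IsArgmin
    (fun v => β * prox x₀ v +
      ∑ i ∈ Finset.range (k + 1), ((i : ℝ) + 1) / 2 * ⟪v - x i, gradient f (x i)⟫)
    (l1Ball n R) (z k)
  x_step : ∀ k < K,
    x (k + 1) = (2 / ((k : ℝ) + 3)) • z k + (((k : ℝ) + 1) / ((k : ℝ) + 3)) • y k

/-- `w` is a hard-thresholding of `x`: a Euclidean projection onto the `s`-sparse vectors. -/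
def IsThreshold {n : ℕ} (s : ℕ) (x w : Vec n) : Prop :=
  IsArgmin (fun v => ‖v - x‖) {v | nnz v ≤ s} w

/-- A run of the restarted accelerated gradient method with sparsity parameter `s` and epoch
length `K`. Here `pt t` is the outer iterate `x_t`, `hat t` its hard-thresholding, and
`x t k`, `y t k`, `z t k` are the inner iterates of epoch `t`. -/
structure RestartRun {n : ℕ} (f : Vec n → ℝ) (R β : ℝ) (s K : ℕ) where
  pt : ℕ → Vec n
  hat : ℕ → Vec n
  x : ℕ → ℕ → Vec n
  y : ℕ → ℕ → Vec n
  z : ℕ → ℕ → Vec n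
  init_mem : pt 0 ∈ l1Ball n R
  init_sparse : nnz (pt 0) ≤ s
  threshold : ∀ t, IsThreshold s (pt t) (hat t)
  epoch : ∀ t, IsAccRun f R β K (hat t) (x t) (y t) (z t)
  next : ∀ t, pt (t + 1) = y t K

/-- The points at which the first-order oracle of `f` is called during the first `T` epochs, in
order: iteration `k` of an epoch calls it once, at `x k` (older answers are kept). -/
def RestartRun.queries {n : ℕ} {f : Vec n → ℝ} {R β : ℝ} {s K : ℕ}
    (r : RestartRun f R β s K) (T : ℕ) : List (Vec n) :=
  (List.range T).flatMap fun t => (List.range (K + 1)).map (r.x t)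

/-- The threshold `√(64 s β e² ln(n) / α) - 1` for the epoch length. -/
def epochBound (n s : ℕ) (α β : ℝ) : ℝ :=
  Real.sqrt (64 * s * β * Real.exp 1 ^ 2 * Real.log n / α) - 1

end SparseL1

end

/-! The prox function `d` is 1-strongly convex in the ℓ₁ norm (`prox_segment_le`), so Nesterov's
estimate sequence (`IsAccRun.mul_le_estimate`) gives, after one epoch from `x̂`, a gap of at most
`4β d(x*) / ((K+1)(K+2))`. Since `d(x*) ≤ ½ e² ln(n) ‖x* - x̂‖₁²` (`prox_le`), the choice of `K`
turns this into `gap ≤ α ‖x* - x̂‖₁² / (32 s)`.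

Sparsity closes the loop. The vector `x* - x̂` has at most `2s` non-zero entries, so Cauchy–Schwarz
replaces ℓ₁ by ℓ₂ at the cost of `2s`. Thresholding at most doubles the Euclidean distance to `x*`,
and quadratic growth bounds that distance by the previous gap. In total `‖x* - x̂‖₁² ≤ (16 s / α) ·
gap`, so every epoch after the initial one halves the gap (`RestartRun.sub_le`). The initial epoch
uses only the ℓ₁ diameter `2R`. The oracle bound counts the halvings. -/

noncomputable section

namespace SparseL1

/-! ### Uniform convexity of squared `ℓ_p` norms for `1 ≤ p < 2` -/

section SmoothedPower

variable {ι : Type*} [Fintype ι]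

/-- Power mean inequality with exponent `q / (1 - q)`, which is at least 1 exactly because `q ≥
1/2`. -/
lemma sum_rpow_one_sub_le {q : ℝ} (hq : 1 / 2 ≤ q) (hq1 : q < 1) {w : ι → ℝ}
    (hw : ∀ i, 0 < w i) :
    ∑ i, w i ^ (1 - q) ≤
      (Fintype.card ι : ℝ) ^ (2 - 1 / q) * (∑ i, w i ^ q) ^ (1 / q - 1) := by
  have hq0 : 0 < q := by linarith
  have h1q : 0 < 1 - q := by linarith
  have hm : (0 : ℝ) ≤ ∑ i, w i ^ (1 - q) := Finset.sum_nonneg fun i _ => by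
    have := hw i; positivity
  have hS : (0 : ℝ) ≤ ∑ i, w i ^ q := Finset.sum_nonneg fun i _ => by
    have := hw i; positivity
  have hr : 1 ≤ q / (1 - q) := by rw [le_div_iff₀ h1q]; linarith
  have h := Real.rpow_sum_le_const_mul_sum_rpow_of_nonneg (Finset.univ)
    (f := fun i => w i ^ (1 - q)) hr (fun i _ => by have := hw i; positivity)
  have h2 : ∀ i, (w i ^ (1 - q)) ^ (q / (1 - q)) = w i ^ q := fun i => by
    rw [← Real.rpow_mul (hw i).le, mul_div_cancel₀ _ h1q.ne']
  simp only [h2, Finset.card_univ] at h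
  have h3 := Real.rpow_le_rpow (by positivity) h (z := 1 / q - 1)
    (by rw [sub_nonneg, le_div_iff₀ hq0]; linarith)
  rw [← Real.rpow_mul hm, Real.mul_rpow (by positivity) hS,
    ← Real.rpow_mul (by positivity)] at h3
  have e1 : q / (1 - q) * (1 / q - 1) = 1 := by field_simp
  have e2 : (q / (1 - q) - 1) * (1 / q - 1) = 2 - 1 / q := by field_simp; ring
  rwa [e1, e2, Real.rpow_one] at h3

/-- Cauchy–Schwarz with weights `w ^ (1 - q)` and `w ^ (q - 1)`. The last sum is the one that
appears in the second derivative of `smoothSq`. -/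
lemma sq_sum_abs_le {q : ℝ} (hq : 1 / 2 ≤ q) (hq1 : q < 1) {w : ι → ℝ} (hw : ∀ i, 0 < w i)
    (h : ι → ℝ) :
    (∑ i, |h i|) ^ 2 ≤ (Fintype.card ι : ℝ) ^ (2 - 1 / q) *
      ((∑ i, w i ^ q) ^ (1 / q - 1) * ∑ i, h i ^ 2 * w i ^ (q - 1)) := by
  have hcs : (∑ i, |h i|) ^ 2 ≤ (∑ i, w i ^ (1 - q)) * ∑ i, h i ^ 2 * w i ^ (q - 1) := by
    refine Finset.sum_sq_le_sum_mul_sum_of_sq_le_mul _ (fun i _ => ?_) (fun i _ => ?_)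
      (fun i _ => ?_)
    · have := hw i; positivity
    · have := hw i; positivity
    · rw [sq_abs, mul_left_comm, ← Real.rpow_add (hw i)]
      simp
  refine hcs.trans ?_
  rw [← mul_assoc]
  refine mul_le_mul_of_nonneg_right (sum_rpow_one_sub_le hq hq1 hw)
    (Finset.sum_nonneg fun i _ => ?_)
  have := hw i
  positivity

/-- The square of the smoothed `ℓ_{2q}` norm of `a + t h`. -/
def smoothSq (q ε : ℝ) (a h : ι → ℝ) (t : ℝ) : ℝ :=
  (∑ i, ((a i + t * h i) ^ 2 + ε) ^ q) ^ (1 / q)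

/-- Second-derivative test. The shift `ε > 0` keeps every base positive, so the real powers are
smooth even where a coordinate vanishes. -/
lemma convexOn_smoothSq_sub [Nonempty ι] {q ε : ℝ} (hq : 1 / 2 ≤ q) (hq1 : q < 1) (hε : 0 < ε)
    (a h : ι → ℝ) :
    ConvexOn ℝ Set.univ fun t => smoothSq q ε a h t -
      (2 * q - 1) * ((Fintype.card ι : ℝ) ^ (2 - 1 / q))⁻¹ * (∑ i, |h i|) ^ 2 * t ^ 2 := by
  have hq0 : 0 < q := by linarith
  set c : ℝ := (2 * q - 1) * ((Fintype.card ι : ℝ) ^ (2 - 1 / q))⁻¹ * (∑ i, |h i|) ^ 2 with hc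
  set w : ι → ℝ → ℝ := fun i t => (a i + t * h i) ^ 2 + ε with hwdef
  have hw : ∀ i t, 0 < w i t := fun i t => by simp only [hwdef]; positivity
  set w' : ι → ℝ → ℝ := fun i t => 2 * h i * (a i + t * h i) with hw'def
  have hdw : ∀ i t, HasDerivAt (w i) (w' i t) t := fun i t => by
    have h1 : HasDerivAt (fun t => a i + t * h i) (1 * h i) t :=
      ((hasDerivAt_id t).mul_const (h i)).const_add (a i)
    refine ((h1.pow 2).add_const ε).congr_deriv ?_
    simp only [hw'def]; push_cast; ring
  have hdw' : ∀ i t, HasDerivAt (w' i) (2 * h i ^ 2) t := fun i t => by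
    have h1 : HasDerivAt (fun t => a i + t * h i) (1 * h i) t :=
      ((hasDerivAt_id t).mul_const (h i)).const_add (a i)
    refine (h1.const_mul (2 * h i)).congr_deriv ?_
    ring
  set S : ℝ → ℝ := fun t => ∑ i, w i t ^ q with hSdef
  have hS : ∀ t, 0 < S t := fun t =>
    Finset.sum_pos (fun i _ => Real.rpow_pos_of_pos (hw i t) q) Finset.univ_nonempty
  set S' : ℝ → ℝ := fun t => ∑ i, w' i t * q * w i t ^ (q - 1) with hS'def
  have hdS : ∀ t, HasDerivAt S (S' t) t := fun t =>
    HasDerivAt.fun_sum fun i _ => (hdw i t).rpow_const (Or.inl (hw i t).ne')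
  set S'' : ℝ → ℝ := fun t => ∑ i, (2 * h i ^ 2 * q * w i t ^ (q - 1) +
    w' i t * q * (w' i t * (q - 1) * w i t ^ (q - 1 - 1))) with hS''def
  have hdS' : ∀ t, HasDerivAt S' (S'' t) t := fun t =>
    HasDerivAt.fun_sum fun i _ =>
      ((hdw' i t).mul_const q).mul ((hdw i t).rpow_const (Or.inl (hw i t).ne'))
  have hdN : ∀ t, HasDerivAt (fun t => S t ^ (1 / q) - c * t ^ 2)
      (S' t * (1 / q) * S t ^ (1 / q - 1) - c * (2 * t)) t := fun t => by
    refine ((hdS t).rpow_const (Or.inl (hS t).ne')).sub ?_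
    simpa using (hasDerivAt_pow 2 t).const_mul c
  have hdN' : ∀ t, HasDerivAt (fun t => S' t * (1 / q) * S t ^ (1 / q - 1) - c * (2 * t))
      (S'' t * (1 / q) * S t ^ (1 / q - 1) +
        S' t * (1 / q) * (S' t * (1 / q - 1) * S t ^ (1 / q - 1 - 1)) - c * 2) t := fun t => by
    refine (((hdS' t).mul_const (1 / q)).mul
      ((hdS t).rpow_const (Or.inl (hS t).ne'))).sub ?_
    simpa using ((hasDerivAt_id t).const_mul 2).const_mul c
  refine convexOn_of_hasDerivWithinAt2_nonneg convex_univ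
    (f' := fun t => S' t * (1 / q) * S t ^ (1 / q - 1) - c * (2 * t))
    (f'' := fun t => S'' t * (1 / q) * S t ^ (1 / q - 1) +
        S' t * (1 / q) * (S' t * (1 / q - 1) * S t ^ (1 / q - 1 - 1)) - c * 2)
    (fun t _ => (hdN t).continuousAt.continuousWithinAt)
    (fun t _ => (hdN t).hasDerivWithinAt) (fun t _ => (hdN' t).hasDerivWithinAt) fun t _ => ?_
  -- Substituting `(a i + t * h i) ^ 2 = w i t - ε` leaves a remainder proportional to `(1 - q) ε ≥
  -- 0`, which is dropped.
  have hS2 : 2 * q * (2 * q - 1) * ∑ i, h i ^ 2 * w i t ^ (q - 1) ≤ S'' t := by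
    rw [Finset.mul_sum]
    refine Finset.sum_le_sum fun i _ => ?_
    have e : w i t ^ (q - 1) = w i t ^ (q - 1 - 1) * w i t := by
      rw [← Real.rpow_add_one (hw i t).ne']; ring_nf
    have hP : 0 ≤ w i t ^ (q - 1 - 1) := (Real.rpow_pos_of_pos (hw i t) _).le
    rw [e]
    have : 0 ≤ 4 * q * (1 - q) * h i ^ 2 * ε * w i t ^ (q - 1 - 1) := by
      have : 0 ≤ 1 - q := by linarith
      positivity
    have key : 2 * h i ^ 2 * q * (w i t ^ (q - 1 - 1) * w i t) +
        w' i t * q * (w' i t * (q - 1) * w i t ^ (q - 1 - 1)) =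
        2 * q * (2 * q - 1) * (h i ^ 2 * (w i t ^ (q - 1 - 1) * w i t)) +
        4 * q * (1 - q) * h i ^ 2 * ε * w i t ^ (q - 1 - 1) := by
      generalize w i t ^ (q - 1 - 1) = P
      simp only [hwdef, hw'def]; ring
    linarith
  have hH := sq_sum_abs_le hq hq1 (fun i => hw i t) h
  have hSp : 0 < S t ^ (1 / q - 1) := Real.rpow_pos_of_pos (hS t) _
  have hSpp : 0 < S t ^ (1 / q - 1 - 1) := Real.rpow_pos_of_pos (hS t) _
  -- The first-derivative term is a square times `1/q - 1 ≥ 0`, so it can be discarded.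
  have h2 : 0 ≤ S' t * (1 / q) * (S' t * (1 / q - 1) * S t ^ (1 / q - 1 - 1)) := by
    have : 0 ≤ 1 / q - 1 := by rw [sub_nonneg, le_div_iff₀ hq0]; linarith
    have e : S' t * (1 / q) * (S' t * (1 / q - 1) * S t ^ (1 / q - 1 - 1)) =
      S' t ^ 2 * (1 / q * (1 / q - 1) * S t ^ (1 / q - 1 - 1)) := by ring
    rw [e]; positivity
  have hcard : (0 : ℝ) < (Fintype.card ι : ℝ) ^ (2 - 1 / q) :=
    Real.rpow_pos_of_pos (by exact_mod_cast Fintype.card_pos) _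
  have h3 : c ≤ (2 * q - 1) * (S t ^ (1 / q - 1) * ∑ i, h i ^ 2 * w i t ^ (q - 1)) := by
    rw [hc, mul_assoc]
    refine mul_le_mul_of_nonneg_left ?_ (by linarith)
    rwa [inv_mul_le_iff₀ hcard]
  have h4 : 2 * (2 * q - 1) * (S t ^ (1 / q - 1) * ∑ i, h i ^ 2 * w i t ^ (q - 1)) ≤
      S'' t * (1 / q) * S t ^ (1 / q - 1) := by
    refine le_trans (le_of_eq ?_) (mul_le_mul_of_nonneg_right
      (mul_le_mul_of_nonneg_right hS2 (by positivity : 0 ≤ 1 / q)) hSp.le)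
    field_simp
  linarith

/-- `2`-uniform convexity of the `ℓ_{2q}` norm along a segment, with modulus measured in `ℓ₁`. -/
lemma rpow_sum_sq_segment_le [Nonempty ι] {q : ℝ} (hq : 1 / 2 ≤ q) (hq1 : q < 1)
    (a h : ι → ℝ) {t : ℝ} (ht0 : 0 ≤ t) (ht1 : t ≤ 1) :
    smoothSq q 0 a h t ≤ (1 - t) * smoothSq q 0 a h 0 + t * smoothSq q 0 a h 1 -
      t * (1 - t) * ((2 * q - 1) * ((Fintype.card ι : ℝ) ^ (2 - 1 / q))⁻¹ *
        (∑ i, |h i|) ^ 2) := by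
  have hq0 : 0 < q := by linarith
  have hcont : ∀ s, Continuous fun ε => smoothSq q ε a h s := fun s => by
    refine Continuous.rpow_const ?_ fun _ => Or.inr (by positivity)
    refine continuous_finsetSum _ fun i _ => ?_
    exact Continuous.rpow_const (by fun_prop) fun _ => Or.inr hq0.le
  have hlim : ∀ s, Filter.Tendsto (fun ε => smoothSq q ε a h s) (nhdsWithin 0 (Set.Ioi 0))
      (nhds (smoothSq q 0 a h s)) := fun s => ((hcont s).tendsto 0).mono_left nhdsWithin_le_nhds
  -- The modulus does not depend on `ε`, so the inequality survives `ε ↓ 0`.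
  refine le_of_tendsto_of_tendsto (hlim t) ((((hlim 0).const_mul (1 - t)).add
    ((hlim 1).const_mul t)).sub_const _) ?_
  filter_upwards [self_mem_nhdsWithin] with ε hε
  have := (convexOn_smoothSq_sub hq hq1 hε a h).2 (Set.mem_univ 0) (Set.mem_univ 1)
    (sub_nonneg.2 ht1) ht0 (by ring)
  simp only [smul_eq_mul, mul_zero, mul_one, zero_add, one_pow] at this
  linarith

end SmoothedPower

/-! ### Norm comparisons and sparsity -/

section Norms

variable {n : ℕ}

lemma l1Norm_nonneg (x : Vec n) : 0 ≤ l1Norm x := Finset.sum_nonneg fun _ _ => abs_nonneg _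

lemma l1Norm_smul (c : ℝ) (x : Vec n) : l1Norm (c • x) = |c| * l1Norm x := by
  simp [l1Norm, abs_mul, Finset.mul_sum]

lemma l1Norm_sub_le (x y : Vec n) : l1Norm (x - y) ≤ l1Norm x + l1Norm y := by
  rw [l1Norm, l1Norm, l1Norm, ← Finset.sum_add_distrib]
  exact Finset.sum_le_sum fun i _ => by simpa using abs_sub (x i) (y i)

lemma convex_l1Ball (R : ℝ) : Convex ℝ (l1Ball n R) := by
  intro x hx y hy a b ha hb hab
  have h : l1Norm (a • x + b • y) ≤ a * l1Norm x + b * l1Norm y := by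
    rw [l1Norm, l1Norm, l1Norm, Finset.mul_sum, Finset.mul_sum, ← Finset.sum_add_distrib]
    refine Finset.sum_le_sum fun i _ => ?_
    simpa [abs_mul, abs_of_nonneg ha, abs_of_nonneg hb] using abs_add_le (a * x i) (b * y i)
  have h1 := mul_le_mul_of_nonneg_left hx.out ha
  have h2 := mul_le_mul_of_nonneg_left hy.out hb
  have h3 : a * R + b * R = R := by rw [← add_mul, hab, one_mul]
  exact (h.trans (by linarith) : _ ≤ R)

lemma inner_le_linfNorm_mul_l1Norm (x y : Vec n) : ⟪x, y⟫ ≤ linfNorm x * l1Norm y := by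
  rw [PiLp.inner_apply, l1Norm, Finset.mul_sum]
  refine Finset.sum_le_sum fun i _ => ?_
  have h1 : |x i| ≤ linfNorm x := norm_le_pi_norm x.ofLp i
  calc ⟪x i, y i⟫ = x i * y i := by simp [mul_comm]
    _ ≤ |x i| * |y i| := (le_abs_self _).trans (abs_mul _ _).le
    _ ≤ _ := mul_le_mul_of_nonneg_right h1 (abs_nonneg _)

lemma lpNorm_sq {p : ℝ} (x : Vec n) :
    lpNorm p x ^ 2 = (∑ i, (x i ^ 2) ^ (p / 2)) ^ (1 / (p / 2)) := by
  have h : ∀ i, (x i ^ 2) ^ (p / 2) = |x i| ^ p := fun i => by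
    rw [← sq_abs, ← Real.rpow_natCast, ← Real.rpow_mul (abs_nonneg _)]
    congr 1; push_cast; ring
  simp only [h]
  rw [lpNorm, ← Real.rpow_natCast, ← Real.rpow_mul (Finset.sum_nonneg fun i _ => by positivity)]
  congr 1; push_cast; ring

lemma lpNorm_le_l1Norm {p : ℝ} (hp : 1 ≤ p) (x : Vec n) : lpNorm p x ≤ l1Norm x := by
  have hp0 : 0 < p := by linarith
  have h : ∑ i, |x i| ^ p ≤ l1Norm x ^ p := by
    have h1 : ∀ i ∈ Finset.univ, |x i| ^ p ≤ l1Norm x ^ (p - 1) * |x i| := fun i hi => by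
      have h2 : |x i| ^ p = |x i| ^ (p - 1) * |x i| := by
        rcases eq_or_ne |x i| 0 with h0 | h0
        · rw [h0, Real.zero_rpow hp0.ne', mul_zero]
        · rw [← Real.rpow_add_one h0]; ring_nf
      rw [h2]
      exact mul_le_mul_of_nonneg_right (Real.rpow_le_rpow (abs_nonneg _)
        (Finset.single_le_sum (fun j _ => abs_nonneg (x j)) hi) (by linarith)) (abs_nonneg _)
    refine (Finset.sum_le_sum h1).trans (le_of_eq ?_)
    rw [← Finset.mul_sum]
    change l1Norm x ^ (p - 1) * l1Norm x = _
    rcases eq_or_ne (l1Norm x) 0 with h0 | h0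
    · rw [h0, Real.zero_rpow hp0.ne', mul_zero]
    · rw [← Real.rpow_add_one h0]; ring_nf
  calc lpNorm p x ≤ (l1Norm x ^ p) ^ (1 / p) :=
        Real.rpow_le_rpow (Finset.sum_nonneg fun i _ => by positivity) h (by positivity)
    _ = l1Norm x := by
        rw [← Real.rpow_mul (l1Norm_nonneg x), mul_one_div_cancel hp0.ne', Real.rpow_one]

/-- Cauchy–Schwarz on the support. -/
lemma l1Norm_sq_le_nnz_mul (x : Vec n) : l1Norm x ^ 2 ≤ nnz x * ‖x‖ ^ 2 := by
  classical
  have h1 : l1Norm x = ∑ i, |x i| * (if x i ≠ 0 then 1 else 0) := by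
    refine Finset.sum_congr rfl fun i _ => ?_
    by_cases h : x i = 0 <;> simp [h]
  have h2 : ∑ i, (if x i ≠ 0 then (1 : ℝ) else 0) ^ 2 = nnz x := by
    simp only [ite_pow, one_pow, zero_pow two_ne_zero, Finset.sum_boole, nnz, hammingNorm]
  rw [h1, EuclideanSpace.norm_sq_eq, ← h2, mul_comm]
  simpa using Finset.sum_mul_sq_le_sq_mul_sq Finset.univ (fun i => |x i|)
    (fun i => if x i ≠ 0 then (1 : ℝ) else 0)

lemma nnz_sub_le (x y : Vec n) : nnz (x - y) ≤ nnz x + nnz y := by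
  classical
  simp only [nnz, hammingNorm]
  refine (Finset.card_le_card ?_).trans (Finset.card_union_le _ _)
  intro i
  simp only [Finset.mem_filter, Finset.mem_univ, true_and, Finset.mem_union]
  intro h
  by_contra! hc
  exact h (by simp [hc.1, hc.2])

end Norms

/-! ### The prox function and its strong convexity -/

section Prox

variable {n : ℕ}

lemma one_lt_log_of_three_le (hn : 3 ≤ n) : 1 < Real.log n := by
  rw [Real.lt_log_iff_exp_lt (by positivity)]
  have : (3 : ℝ) ≤ n := by exact_mod_cast hn
  linarith [Real.exp_one_lt_d9]

lemma one_lt_proxExponent (hn : 3 ≤ n) : 1 < proxExponent n := by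
  have := one_lt_log_of_three_le hn
  have : 0 < 1 / Real.log n := by positivity
  rw [proxExponent]; linarith

lemma proxExponent_lt_two (hn : 3 ≤ n) : proxExponent n < 2 := by
  have := one_lt_log_of_three_le hn
  have : 1 / Real.log n < 1 := by rw [div_lt_one (by linarith)]; exact this
  rw [proxExponent]; linarith

/-- The reason for the choice of `p`: powers of the dimension collapse to the constant `e`. -/
lemma rpow_proxExponent_sub_one (hn : 3 ≤ n) :
    (n : ℝ) ^ (proxExponent n - 1) = Real.exp 1 := by
  have h := one_lt_log_of_three_le hn
  rw [Real.rpow_def_of_pos (by positivity), proxExponent, add_sub_cancel_left,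
    mul_one_div_cancel (by linarith)]

lemma prox_nonneg (hn : 3 ≤ n) (x₀ z : Vec n) : 0 ≤ prox x₀ z := by
  have := one_lt_log_of_three_le hn
  rw [prox]; positivity

lemma prox_self (hn : 3 ≤ n) (x₀ : Vec n) : prox x₀ x₀ = 0 := by
  have := one_lt_proxExponent hn
  have h1 : proxExponent n ≠ 0 := by linarith
  simp [prox, lpNorm, Real.zero_rpow h1, Real.zero_rpow (inv_ne_zero h1)]

lemma prox_le (hn : 3 ≤ n) (x₀ z : Vec n) :
    prox x₀ z ≤ 1 / 2 * Real.exp 1 ^ 2 * Real.log n * l1Norm (z - x₀) ^ 2 := by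
  have hl := one_lt_log_of_three_le hn
  have hp := one_lt_proxExponent hn
  have hp2 := proxExponent_lt_two hn
  have h1 : (n : ℝ) ^ ((proxExponent n - 1) * (2 - proxExponent n) / proxExponent n) ≤
      Real.exp 1 := by
    rw [← rpow_proxExponent_sub_one hn]
    refine Real.rpow_le_rpow_of_exponent_le (by exact_mod_cast (by omega : 1 ≤ n)) ?_
    rw [div_le_iff₀ (by linarith)]
    exact mul_le_mul_of_nonneg_left (by linarith) (by linarith)
  have h2 : lpNorm (proxExponent n) (z - x₀) ^ 2 ≤ l1Norm (z - x₀) ^ 2 :=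
    pow_le_pow_left₀ (Real.rpow_nonneg (Finset.sum_nonneg fun i _ => by positivity) _)
      (lpNorm_le_l1Norm hp.le _) 2
  rw [prox]
  calc _ ≤ 1 / 2 * Real.exp 1 * Real.log n * Real.exp 1 * l1Norm (z - x₀) ^ 2 := by gcongr
    _ = _ := by ring

/-- The prox function is `1`-strongly convex with respect to the `ℓ₁` norm. -/
lemma prox_segment_le (hn : 3 ≤ n) (x₀ x z : Vec n) {t : ℝ} (ht0 : 0 ≤ t) (ht1 : t ≤ 1) :
    prox x₀ (z + t • (x - z)) ≤
      (1 - t) * prox x₀ z + t * prox x₀ x - t * (1 - t) * (1 / 2 * l1Norm (x - z) ^ 2) := by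
  have hl := one_lt_log_of_three_le hn
  have hp := one_lt_proxExponent hn
  have hp2 := proxExponent_lt_two hn
  have hn0 : (0 : ℝ) < n := by positivity
  have : Nonempty (Fin n) := ⟨⟨0, by omega⟩⟩
  set p := proxExponent n with hpdef
  have hsm : ∀ s : ℝ, lpNorm p (z + s • (x - z) - x₀) ^ 2 =
      smoothSq (p / 2) 0 (fun i => z i - x₀ i) (fun i => x i - z i) s := fun s => by
    rw [lpNorm_sq, smoothSq]
    congr 1
    refine Finset.sum_congr rfl fun i _ => ?_
    simp only [PiLp.sub_apply, PiLp.add_apply, PiLp.smul_apply, smul_eq_mul, add_zero]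
    congr 2; ring
  have key := rpow_sum_sq_segment_le (q := p / 2) (by linarith) (by linarith)
    (fun i => z i - x₀ i) (fun i => x i - z i) ht0 ht1
  rw [← hsm, ← hsm, ← hsm, zero_smul, add_zero, one_smul, add_sub_cancel, Fintype.card_fin] at key
  have hl1 : ∑ i, |x i - z i| = l1Norm (x - z) := rfl
  rw [hl1] at key
  set D : ℝ := 1 / 2 * Real.exp 1 * Real.log n * (n : ℝ) ^ ((p - 1) * (2 - p) / p) with hD
  have hD0 : 0 ≤ D := by positivity
  -- The normalisation of `d` is made for this: `p - 1 = 1 / ln n` cancels `ln n`, and the powers of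
  -- `n` combine to `n ^ (-(p - 1)) = e⁻¹`.
  have hDc : D * ((2 * (p / 2) - 1) * ((n : ℝ) ^ (2 - 1 / (p / 2)))⁻¹) = 1 / 2 := by
    have e1 : 2 * (p / 2) - 1 = 1 / Real.log n := by rw [hpdef, proxExponent]; ring
    have e2 : (n : ℝ) ^ ((p - 1) * (2 - p) / p) * ((n : ℝ) ^ (2 - 1 / (p / 2)))⁻¹ =
        (Real.exp 1)⁻¹ := by
      rw [← rpow_proxExponent_sub_one hn, ← Real.rpow_neg hn0.le, ← Real.rpow_neg hn0.le,
        ← Real.rpow_add hn0]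
      congr 1
      have : p ≠ 0 := by linarith
      rw [← hpdef]
      field_simp; ring
    rw [e1, hD]
    calc _ = 1 / 2 * Real.exp 1 * (Real.log n * (1 / Real.log n)) *
          ((n : ℝ) ^ ((p - 1) * (2 - p) / p) * ((n : ℝ) ^ (2 - 1 / (p / 2)))⁻¹) := by ring
      _ = 1 / 2 := by
        rw [e2, mul_one_div_cancel (by linarith), mul_one, mul_assoc,
          mul_inv_cancel₀ (Real.exp_pos 1).ne', mul_one]
  have hpr : ∀ v, prox x₀ v = D * lpNorm p (v - x₀) ^ 2 := fun v => rfl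
  rw [hpr, hpr, hpr]
  refine (mul_le_mul_of_nonneg_left key hD0).trans (le_of_eq ?_)
  rw [← hDc]; ring

/-- A minimizer of a strongly convex function over a convex set satisfies a growth condition. -/
lemma argmin_growth {Φ : Vec n → ℝ} {S : Set (Vec n)} (hS : Convex ℝ S) {m : ℝ} {x z : Vec n}
    (hΦ : ∀ t : ℝ, 0 ≤ t → t ≤ 1 → Φ (z + t • (x - z)) ≤
      (1 - t) * Φ z + t * Φ x - t * (1 - t) * m)
    (hz : IsArgmin Φ S z) (hx : x ∈ S) : Φ z + m ≤ Φ x := by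
  have hlim : Filter.Tendsto (fun t : ℝ => Φ z + (1 - t) * m) (nhdsWithin 0 (Set.Ioi 0))
      (nhds (Φ z + m)) := by
    have hc : Continuous fun t : ℝ => Φ z + (1 - t) * m := by fun_prop
    simpa using (hc.tendsto 0).mono_left nhdsWithin_le_nhds
  refine le_of_tendsto hlim ?_
  filter_upwards [Ioo_mem_nhdsGT (zero_lt_one' ℝ)] with t ht
  have h1 : Φ z ≤ Φ (z + t • (x - z)) :=
    hz.2 (hS.add_smul_sub_mem hz.1 hx ⟨ht.1.le, ht.2.le⟩)
  have h2 := hΦ t ht.1.le ht.2.le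
  -- Dividing by `t` leaves `(1 - t) * m`, which tends to `m` as `t ↓ 0`.
  have h3 : t * (Φ z + (1 - t) * m) ≤ t * Φ x := by linarith
  exact le_of_mul_le_mul_left h3 ht.1

/-- The centre `x₀` minimizes `d` with value 0, so strong convexity gives quadratic growth from it.
-/
lemma half_l1Norm_sq_le_prox (hn : 3 ≤ n) (x₀ x : Vec n) :
    1 / 2 * l1Norm (x - x₀) ^ 2 ≤ prox x₀ x := by
  have := argmin_growth (S := Set.univ) convex_univ
    (fun t h0 h1 => prox_segment_le hn x₀ x x₀ h0 h1)
    ⟨Set.mem_univ _, fun y _ => by simpa [prox_self hn] using prox_nonneg hn x₀ y⟩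
    (Set.mem_univ x)
  rwa [prox_self hn, zero_add] at this

end Prox

/-! ### First-order consequences of convexity and smoothness on the ball -/

section FirstOrder

variable {n : ℕ} {f : Vec n → ℝ} {R β : ℝ} {x y : Vec n}

lemma hasDerivAt_segment {t : ℝ} (hf : DifferentiableAt ℝ f (x + t • (y - x))) :
    HasDerivAt (fun s : ℝ => f (x + s • (y - x)))
      ⟪gradient f (x + t • (y - x)), y - x⟫ t := by
  have h1 : HasDerivAt (fun s : ℝ => x + s • (y - x)) ((1 : ℝ) • (y - x)) t :=
    ((hasDerivAt_id t).smul_const (y - x)).const_add x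
  have h2 := hf.hasGradientAt.hasFDerivAt.comp_hasDerivAt t h1
  simpa [Function.comp_def] using h2

lemma add_inner_gradient_le (hc : ConvexOn ℝ (l1Ball n R) f)
    (hd : ∀ x ∈ l1Ball n R, DifferentiableAt ℝ f x) (hx : x ∈ l1Ball n R) (hy : y ∈ l1Ball n R) :
    f x + ⟪gradient f x, y - x⟫ ≤ f y := by
  have hseg : ∀ s ∈ Set.Icc (0 : ℝ) 1, x + s • (y - x) ∈ l1Ball n R :=
    fun s hs => (convex_l1Ball R).add_smul_sub_mem hx hy hs
  have hg : ConvexOn ℝ (Set.Icc (0 : ℝ) 1) fun s : ℝ => f (x + s • (y - x)) := by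
    refine ⟨convex_Icc 0 1, fun a ha b hb u v hu hv huv => ?_⟩
    have h := hc.2 (hseg a ha) (hseg b hb) hu hv huv
    have e : x + (u • a + v • b) • (y - x) =
        u • (x + a • (y - x)) + v • (x + b • (y - x)) := by
      have : v = 1 - u := by linarith
      subst this
      module
    simpa only [e] using h
  have h0 := hasDerivAt_segment (x := x) (y := y) (t := 0) (hd _ (hseg 0 (by simp)))
  have := hg.le_slope_of_hasDerivAt (by simp) (by simp) zero_lt_one h0
  simp only [slope_def_field, zero_smul, add_zero, one_smul, add_sub_cancel, sub_zero,
    div_one] at this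
  linarith

lemma le_quadratic_upper_bound (hd : ∀ x ∈ l1Ball n R, DifferentiableAt ℝ f x)
    (hs : L1Smooth f R β) (hx : x ∈ l1Ball n R) (hy : y ∈ l1Ball n R) :
    f y ≤ f x + ⟪gradient f x, y - x⟫ + β / 2 * l1Norm (y - x) ^ 2 := by
  have hseg : ∀ s ∈ Set.Icc (0 : ℝ) 1, x + s • (y - x) ∈ l1Ball n R :=
    fun s hs => (convex_l1Ball R).add_smul_sub_mem hx hy hs
  set G : ℝ → ℝ := fun t => f (x + t • (y - x)) -
    (t * ⟪gradient f x, y - x⟫ + β / 2 * l1Norm (y - x) ^ 2 * t ^ 2) with hG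
  have hder : ∀ t ∈ Set.Icc (0 : ℝ) 1, HasDerivAt G (⟪gradient f (x + t • (y - x)), y - x⟫ -
      (1 * ⟪gradient f x, y - x⟫ + β / 2 * l1Norm (y - x) ^ 2 * (2 * t))) t := fun t ht => by
    refine (hasDerivAt_segment (hd _ (hseg t ht))).sub
      (((hasDerivAt_id t).mul_const _).add ?_)
    simpa using (hasDerivAt_pow 2 t).const_mul (β / 2 * l1Norm (y - x) ^ 2)
  -- Hölder and the Lipschitz bound make `G' ≤ 0`; monotonicity replaces integration of the
  -- gradient.
  have hanti : AntitoneOn G (Set.Icc 0 1) := by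
    refine antitoneOn_of_deriv_nonpos (convex_Icc 0 1)
      (fun t ht => (hder t ht).continuousAt.continuousWithinAt)
      (fun t ht => (hder t (interior_subset ht)).differentiableAt.differentiableWithinAt)
      fun t ht => ?_
    have ht := interior_subset ht
    rw [(hder t ht).deriv]
    have h1 := inner_le_linfNorm_mul_l1Norm (gradient f (x + t • (y - x)) - gradient f x) (y - x)
    have h2 := hs _ (hseg t ht) x hx
    rw [add_sub_cancel_left, l1Norm_smul, abs_of_nonneg ht.1] at h2
    have h3 := mul_le_mul_of_nonneg_right h2 (l1Norm_nonneg (y - x))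
    rw [inner_sub_left] at h1
    linarith
  have := hanti (Set.left_mem_Icc.2 zero_le_one) (Set.right_mem_Icc.2 zero_le_one) zero_le_one
  simp only [hG, zero_smul, add_zero, one_smul, add_sub_cancel, zero_mul, one_mul, one_pow,
    mul_one, zero_pow two_ne_zero, mul_zero, sub_zero] at this
  linarith

end FirstOrder

/-! ### Nesterov's accelerated method -/

section Accelerated

variable {n : ℕ} {f : Vec n → ℝ} {R β : ℝ} {K : ℕ} {x₀ : Vec n} {x y z : ℕ → Vec n}

/-- The weighted model `β d + ∑ (i+1)/2 (f(xᵢ) + ⟨∇f(xᵢ), · - xᵢ⟩)` of the accelerated method. -/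
def estimate (f : Vec n → ℝ) (β : ℝ) (x₀ : Vec n) (x : ℕ → Vec n) (k : ℕ) (v : Vec n) : ℝ :=
  β * prox x₀ v + ∑ i ∈ Finset.range (k + 1),
    ((i : ℝ) + 1) / 2 * (f (x i) + ⟪gradient f (x i), v - x i⟫)

/-- The model differs from the objective of the `z`-step only by terms constant in `v`. -/
lemma IsAccRun.isArgmin_estimate (h : IsAccRun f R β K x₀ x y z) {k : ℕ} (hk : k ≤ K) :
    IsArgmin (estimate f β x₀ x k) (l1Ball n R) (z k) := by
  refine ⟨(h.z_step k hk).1, fun v hv => ?_⟩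
  have h1 := (h.z_step k hk).2 hv
  simp only [Set.mem_ofPred_eq] at h1
  simp only [Set.mem_ofPred_eq, estimate, mul_add, Finset.sum_add_distrib]
  simp only [real_inner_comm] at h1 ⊢
  linarith

lemma estimate_segment_le (hn : 3 ≤ n) (hβ : 0 ≤ β) (k : ℕ) (v u : Vec n) {t : ℝ} (ht0 : 0 ≤ t)
    (ht1 : t ≤ 1) :
    estimate f β x₀ x k (u + t • (v - u)) ≤ (1 - t) * estimate f β x₀ x k u +
      t * estimate f β x₀ x k v - t * (1 - t) * (β / 2 * l1Norm (v - u) ^ 2) := by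
  have h1 := mul_le_mul_of_nonneg_left (prox_segment_le hn x₀ v u ht0 ht1) hβ
  have h2 : ∑ i ∈ Finset.range (k + 1), ((i : ℝ) + 1) / 2 *
        (f (x i) + ⟪gradient f (x i), u + t • (v - u) - x i⟫) =
      (1 - t) * ∑ i ∈ Finset.range (k + 1), ((i : ℝ) + 1) / 2 *
        (f (x i) + ⟪gradient f (x i), u - x i⟫) +
      t * ∑ i ∈ Finset.range (k + 1), ((i : ℝ) + 1) / 2 *
        (f (x i) + ⟪gradient f (x i), v - x i⟫) := by
    rw [Finset.mul_sum, Finset.mul_sum, ← Finset.sum_add_distrib]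
    refine Finset.sum_congr rfl fun i _ => ?_
    simp only [inner_sub_right, inner_add_right, inner_smul_right]
    ring
  simp only [estimate, h2]
  linarith

lemma IsAccRun.estimate_growth (h : IsAccRun f R β K x₀ x y z) (hn : 3 ≤ n) (hβ : 0 ≤ β) {k : ℕ}
    (hk : k ≤ K) {v : Vec n} (hv : v ∈ l1Ball n R) :
    estimate f β x₀ x k (z k) + β / 2 * l1Norm (v - z k) ^ 2 ≤ estimate f β x₀ x k v :=
  argmin_growth (convex_l1Ball R) (fun _ h0 h1 => estimate_segment_le hn hβ k v (z k) h0 h1)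
    (h.isArgmin_estimate hk) hv

lemma IsAccRun.x_mem (h : IsAccRun f R β K x₀ x y z) (hx₀ : x₀ ∈ l1Ball n R) {k : ℕ}
    (hk : k ≤ K) : x k ∈ l1Ball n R := by
  cases k with
  | zero => rwa [h.init]
  | succ k =>
    rw [h.x_step k (by omega)]
    refine convex_l1Ball R (h.z_step k (by omega)).1 (h.y_step k (by omega)).1
      (by positivity) (by positivity) ?_
    field_simp; ring

/-- The gradient step decreases `f` below the quadratic model at every feasible point. -/
lemma IsAccRun.le_model (h : IsAccRun f R β K x₀ x y z)
    (hd : ∀ x ∈ l1Ball n R, DifferentiableAt ℝ f x) (hs : L1Smooth f R β)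
    (hx₀ : x₀ ∈ l1Ball n R) {k : ℕ} (hk : k ≤ K) {v : Vec n} (hv : v ∈ l1Ball n R) :
    f (y k) ≤ f (x k) + ⟪gradient f (x k), v - x k⟫ + β / 2 * l1Norm (v - x k) ^ 2 := by
  have h1 := le_quadratic_upper_bound hd hs (h.x_mem hx₀ hk) (h.y_step k hk).1
  have h2 := (h.y_step k hk).2 hv
  simp only [Set.mem_ofPred_eq, real_inner_comm] at h2
  linarith

/-- Nesterov's estimate-sequence inequality. -/
lemma IsAccRun.mul_le_estimate (h : IsAccRun f R β K x₀ x y z) (hn : 3 ≤ n) (hβ : 0 ≤ β)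
    (hc : ConvexOn ℝ (l1Ball n R) f) (hd : ∀ x ∈ l1Ball n R, DifferentiableAt ℝ f x)
    (hs : L1Smooth f R β) (hx₀ : x₀ ∈ l1Ball n R) {k : ℕ} (hk : k ≤ K) :
    ∀ v ∈ l1Ball n R, ((k : ℝ) + 1) * (k + 2) / 4 * f (y k) ≤ estimate f β x₀ x k v := by
  induction k with
  | zero =>
    intro v hv
    have h1 := h.le_model hd hs hx₀ hk hv
    have h2 := mul_le_mul_of_nonneg_left (half_l1Norm_sq_le_prox hn x₀ v) hβ
    have h3 : 0 ≤ β * l1Norm (v - x₀) ^ 2 := by positivity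
    simp only [estimate, zero_add, Finset.range_one, Finset.sum_singleton, Nat.cast_zero]
    rw [h.init] at h1 ⊢
    linarith
  | succ k ih =>
    intro v hv
    have hk' : k ≤ K := by omega
    have hz := (h.z_step k hk').1
    have hy := (h.y_step k hk').1
    have hx := h.x_mem hx₀ hk
    have hk0 : (0 : ℝ) ≤ k := k.cast_nonneg
    -- With `A_k = (k+1)(k+2)/4`, growth around `z k` and induction at `z k` give `A_k f(y_k) + β/2
    -- ‖v - z_k‖₁²` as a lower bound for the old model at `v`.
    have h1 := h.estimate_growth hn hβ hk' hv
    have h2 := ih hk' (z k) hz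
    have h3 := mul_le_mul_of_nonneg_left (add_inner_gradient_le hc hd hx hy)
      (by positivity : 0 ≤ ((k : ℝ) + 1) * (k + 2) / 4)
    set τ : ℝ := 2 / ((k : ℝ) + 3) with hτ
    have hτ0 : 0 ≤ τ := by positivity
    have hτ1 : τ ≤ 1 := by rw [hτ, div_le_one (by positivity)]; linarith
    have hxs := h.x_step k (by omega)
    have e1 : ((k : ℝ) + 1) / (k + 3) = 1 - τ := by rw [hτ]; field_simp; ring
    rw [e1, ← hτ] at hxs
    -- This competitor for the gradient step is chosen so that its displacement from `x (k + 1)` is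
    -- exactly `τ • (v - z k)`.
    have hw : y k + τ • (v - y k) ∈ l1Ball n R :=
      (convex_l1Ball R).add_smul_sub_mem hy hv ⟨hτ0, hτ1⟩
    have h4 := h.le_model hd hs hx₀ hk hw
    have e2 : y k + τ • (v - y k) - x (k + 1) = τ • (v - z k) := by rw [hxs]; module
    rw [e2, l1Norm_smul, inner_smul_right, abs_of_nonneg hτ0] at h4
    have e3 : y k - x (k + 1) = τ • (y k - z k) := by rw [hxs]; module
    rw [e3, inner_smul_right] at h3
    have e4 : v - x (k + 1) = (v - z k) + (1 - τ) • (z k - y k) := by rw [hxs]; module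
    have e5 : estimate f β x₀ x (k + 1) v = estimate f β x₀ x k v +
        ((k : ℝ) + 2) / 2 * (f (x (k + 1)) + (⟪gradient f (x (k + 1)), v - z k⟫ -
          (1 - τ) * ⟪gradient f (x (k + 1)), y k - z k⟫)) := by
      rw [estimate, Finset.sum_range_succ, ← add_assoc, ← estimate, e4, inner_add_right,
        inner_smul_right, ← neg_sub (y k) (z k), inner_neg_right]
      push_cast; ring
    rw [e5]
    have hA : (0 : ℝ) ≤ ((k : ℝ) + 2) * (k + 3) / 4 := by positivity
    have h5 := mul_le_mul_of_nonneg_left h4 hA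
    -- `A_{k+1} τ` is the weight of the new linear term; `e7` makes the `y k - z k` terms cancel;
    -- and `A_{k+1} τ² = (k+2)/(k+3) ≤ 1` lets the growth term absorb the quadratic error in `h6`.
    have e6 : ((k : ℝ) + 2) * (k + 3) / 4 * τ = (k + 2) / 2 := by rw [hτ]; field_simp; ring
    have e7 : ((k : ℝ) + 1) * (k + 2) / 4 * τ = (k + 2) / 2 * (1 - τ) := by
      rw [hτ]; field_simp; ring
    have h6 : ((k : ℝ) + 2) * (k + 3) / 4 * (β / 2 * (τ * l1Norm (v - z k)) ^ 2) ≤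
        β / 2 * l1Norm (v - z k) ^ 2 := by
      have : ((k : ℝ) + 2) * (k + 3) / 4 * (β / 2 * (τ * l1Norm (v - z k)) ^ 2) =
        (((k : ℝ) + 2) * (k + 3) / 4 * τ * τ) * (β / 2 * l1Norm (v - z k) ^ 2) := by ring
      rw [this, e6]
      refine mul_le_of_le_one_left (by positivity) ?_
      rw [hτ, div_mul_div_comm, div_le_one (by positivity)]
      linarith
    set I := ⟪gradient f (x (k + 1)), v - z k⟫
    set J := ⟪gradient f (x (k + 1)), y k - z k⟫
    have e8 : ((k : ℝ) + 2) * (k + 3) / 4 * (f (x (k + 1)) + τ * I +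
          β / 2 * (τ * l1Norm (v - z k)) ^ 2) =
        ((k : ℝ) + 2) * (k + 3) / 4 * f (x (k + 1)) + (k + 2) / 2 * I +
          ((k : ℝ) + 2) * (k + 3) / 4 * (β / 2 * (τ * l1Norm (v - z k)) ^ 2) := by
      rw [← e6]; ring
    have e9 : ((k : ℝ) + 1) * (k + 2) / 4 * (f (x (k + 1)) + τ * J) =
        ((k : ℝ) + 1) * (k + 2) / 4 * f (x (k + 1)) + (k + 2) / 2 * (1 - τ) * J := by
      rw [← e7]; ring
    rw [e8] at h5
    rw [e9] at h3
    push_cast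
    linarith

/-- Convergence rate of the accelerated method. -/
lemma IsAccRun.mul_sub_le (h : IsAccRun f R β K x₀ x y z) (hn : 3 ≤ n) (hβ : 0 ≤ β)
    (hc : ConvexOn ℝ (l1Ball n R) f) (hd : ∀ x ∈ l1Ball n R, DifferentiableAt ℝ f x)
    (hs : L1Smooth f R β) (hx₀ : x₀ ∈ l1Ball n R) {v : Vec n} (hv : v ∈ l1Ball n R) :
    ((K : ℝ) + 1) * (K + 2) * (f (y K) - f v) ≤ 4 * β * prox x₀ v := by
  have h1 := h.mul_le_estimate hn hβ hc hd hs hx₀ le_rfl v hv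
  have h2 : ∑ i ∈ Finset.range (K + 1), ((i : ℝ) + 1) / 2 *
      (f (x i) + ⟪gradient f (x i), v - x i⟫) ≤
      ∑ i ∈ Finset.range (K + 1), ((i : ℝ) + 1) / 2 * f v :=
    Finset.sum_le_sum fun i hi => mul_le_mul_of_nonneg_left
      (add_inner_gradient_le hc hd (h.x_mem hx₀ (by simpa [Nat.lt_succ_iff] using hi)) hv)
      (by positivity)
  have h3 : ∀ m : ℕ, ∑ i ∈ Finset.range (m + 1), ((i : ℝ) + 1) / 2 =
      ((m : ℝ) + 1) * (m + 2) / 4 := fun m => by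
    induction m with
    | zero => norm_num
    | succ m ih => rw [Finset.sum_range_succ, ih]; push_cast; ring
  rw [← Finset.sum_mul, h3] at h2
  rw [estimate] at h1
  linarith

end Accelerated

/-! ### Hard-thresholding -/

section Threshold

variable {n s : ℕ} {x w u : Vec n} {R : ℝ}

/-- Restricting `x` to the support of `w` gives an `s`-sparse competitor that is no farther from `x`
in any coordinate; optimality of `w` forces equality in each. -/
lemma IsThreshold.eq_of_ne_zero (h : IsThreshold s x w) {i : Fin n} (hi : w i ≠ 0) :
    w i = x i := by
  classical
  set v : Vec n := WithLp.toLp 2 fun j => if w j = 0 then 0 else x j with hv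
  have hvj : ∀ j, v j = if w j = 0 then 0 else x j := fun j => rfl
  have hvs : nnz v ≤ s := by
    refine le_trans ?_ h.1
    simp only [nnz, hammingNorm]
    refine Finset.card_le_card fun j => ?_
    simp only [Finset.mem_filter, Finset.mem_univ, true_and, hvj]
    intro hj h0
    exact hj (if_pos h0)
  have hle : ‖w - x‖ ≤ ‖v - x‖ := h.2 hvs
  have hsq := pow_le_pow_left₀ (norm_nonneg _) hle 2
  rw [EuclideanSpace.norm_sq_eq, EuclideanSpace.norm_sq_eq] at hsq
  have hterm : ∀ j ∈ Finset.univ, ‖(v - x) j‖ ^ 2 ≤ ‖(w - x) j‖ ^ 2 := fun j _ => by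
    by_cases h0 : w j = 0
    · simp [hvj, h0]
    · simp only [PiLp.sub_apply, hvj, if_neg h0, sub_self, norm_zero, zero_pow two_ne_zero]
      positivity
  have heq := (Finset.sum_eq_sum_iff_of_le hterm).1
    (le_antisymm (Finset.sum_le_sum hterm) hsq) i (Finset.mem_univ i)
  simp only [PiLp.sub_apply, hvj, if_neg hi, sub_self, norm_zero, zero_pow two_ne_zero] at heq
  exact sub_eq_zero.1 (norm_eq_zero.1 (pow_eq_zero_iff two_ne_zero |>.1 heq.symm))

lemma IsThreshold.mem_l1Ball (h : IsThreshold s x w) (hx : x ∈ l1Ball n R) :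
    w ∈ l1Ball n R := by
  refine le_trans (Finset.sum_le_sum fun i _ => ?_) hx.out
  by_cases h0 : w i = 0
  · simp [h0]
  · rw [h.eq_of_ne_zero h0]

/-- The sparse `u` is itself a competitor for the projection; the rest is the triangle inequality.
-/
lemma IsThreshold.norm_sub_le (h : IsThreshold s x w) (hu : nnz u ≤ s) :
    ‖u - w‖ ≤ 2 * ‖x - u‖ := by
  have h1 : ‖w - x‖ ≤ ‖u - x‖ := h.2 hu
  have h2 := norm_sub_le_norm_sub_add_norm_sub u x w
  rw [norm_sub_rev x w] at h2
  rw [norm_sub_rev u x] at h1 h2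
  linarith

end Threshold

/-! ### Halving per epoch and the oracle count -/

section Restart

variable {n s K : ℕ} {R α β : ℝ} {f : Vec n → ℝ} {xstar : Vec n}

lemma IsProblem.isArgmin (h : IsProblem f R α β s xstar) : IsArgmin f (l1Ball n R) xstar := by
  have : xstar ∈ optSet f R := by rw [h.unique_opt]; rfl
  exact this

lemma IsProblem.norm_sub_sq_le (h : IsProblem f R α β s xstar) {x : Vec n}
    (hx : x ∈ l1Ball n R) : ‖x - xstar‖ ^ 2 ≤ 2 / α * (f x - f xstar) := by
  obtain ⟨w, hw, hle⟩ := h.growth x hx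
  rw [h.unique_opt] at hw
  rwa [Set.mem_singleton_iff.1 hw] at hle

lemma RestartRun.pt_mem (r : RestartRun f R β s K) (t : ℕ) : r.pt t ∈ l1Ball n R := by
  cases t with
  | zero => exact r.init_mem
  | succ t => rw [r.next]; exact ((r.epoch t).y_step K le_rfl).1

lemma RestartRun.length_queries (r : RestartRun f R β s K) (T : ℕ) :
    (r.queries T).length = T * (K + 1) := by
  simp [RestartRun.queries, List.length_flatMap]

lemma le_mul_of_epochBound_le (hα : 0 < α) (hK : epochBound n s α β ≤ K) :
    64 * (s * (β * Real.exp 1 ^ 2 * Real.log n)) ≤ α * (((K : ℝ) + 1) * (K + 2)) := by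
  have h1 : Real.sqrt (64 * s * β * Real.exp 1 ^ 2 * Real.log n / α) ≤ (K : ℝ) + 1 := by
    rw [epochBound] at hK; linarith
  have h2 := (Real.sqrt_le_iff.1 h1).2
  rw [div_le_iff₀ hα] at h2
  have h3 : ((K : ℝ) + 1) ^ 2 * α ≤ α * (((K : ℝ) + 1) * (K + 2)) := by
    have : (0 : ℝ) ≤ K := K.cast_nonneg
    rw [mul_comm]
    refine mul_le_mul_of_nonneg_left ?_ hα.le
    nlinarith
  linarith

/-- The progress of one epoch in terms of the `ℓ₁` distance of its starting point. -/
lemma RestartRun.epoch_le (hn : 3 ≤ n) (hs : 1 ≤ s) (hα : 0 < α) (hβ : 0 ≤ β)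
    (hK : epochBound n s α β ≤ K) (h : IsProblem f R α β s xstar) (r : RestartRun f R β s K)
    (t : ℕ) :
    32 * s * (f (r.pt (t + 1)) - f xstar) ≤ α * l1Norm (xstar - r.hat t) ^ 2 := by
  have hs0 : (0 : ℝ) < s := by exact_mod_cast hs
  have h1 := (r.epoch t).mul_sub_le hn hβ h.convex h.differentiable h.smooth
    ((r.threshold t).mem_l1Ball (r.pt_mem t)) h.isArgmin.1
  rw [← r.next] at h1
  have h2 := mul_le_mul_of_nonneg_left (prox_le hn (r.hat t) xstar)
    (by positivity : 0 ≤ 4 * β)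
  have h3 := mul_le_mul_of_nonneg_right (le_mul_of_epochBound_le (n := n) (s := s) hα hK)
    (sq_nonneg (l1Norm (xstar - r.hat t)))
  have h4 := mul_le_mul_of_nonneg_left (h1.trans h2) (by positivity : (0 : ℝ) ≤ 32 * s)
  have hE : (0 : ℝ) < ((K : ℝ) + 1) * (K + 2) := by positivity
  refine le_of_mul_le_mul_left ?_ hE
  linarith

lemma RestartRun.sub_le (hn : 3 ≤ n) (hs : 1 ≤ s) (hα : 0 < α) (hβ : 0 ≤ β)
    (hK : epochBound n s α β ≤ K) (h : IsProblem f R α β s xstar) (r : RestartRun f R β s K)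
    (t : ℕ) :
    f (r.pt (t + 1)) - f xstar ≤ α * R ^ 2 / s * ((2 : ℝ) ^ (t + 3))⁻¹ := by
  have hs0 : (0 : ℝ) < s := by exact_mod_cast hs
  induction t with
  | zero =>
    have h1 := r.epoch_le hn hs hα hβ hK h 0
    -- The diameter bound yields `4αR² / (32 s) = αR² / (8 s)`, whence the exponent `t + 3`.
    have h2 : l1Norm (xstar - r.hat 0) ≤ 2 * R := by
      have ha : l1Norm xstar ≤ R := h.isArgmin.1
      have hb : l1Norm (r.hat 0) ≤ R := (r.threshold 0).mem_l1Ball (r.pt_mem 0)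
      linarith [l1Norm_sub_le xstar (r.hat 0)]
    have h3 := mul_le_mul_of_nonneg_left (pow_le_pow_left₀ (l1Norm_nonneg _) h2 2) hα.le
    have h4 : α * R ^ 2 / s * ((2 : ℝ) ^ (0 + 3))⁻¹ = α * R ^ 2 / (8 * s) := by
      field_simp; norm_num
    rw [h4, le_div_iff₀ (by positivity)]
    linarith
  | succ t ih =>
    have h1 := r.epoch_le hn hs hα hβ hK h (t + 1)
    have h2 := l1Norm_sq_le_nnz_mul (xstar - r.hat (t + 1))
    have h3 : (nnz (xstar - r.hat (t + 1)) : ℝ) ≤ 2 * s := by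
      have ha := nnz_sub_le xstar (r.hat (t + 1))
      have hb := h.sparse_opt
      have hc : nnz (r.hat (t + 1)) ≤ s := (r.threshold (t + 1)).1
      exact_mod_cast (by omega : nnz (xstar - r.hat (t + 1)) ≤ 2 * s)
    have h4 := pow_le_pow_left₀ (norm_nonneg _)
      ((r.threshold (t + 1)).norm_sub_le h.sparse_opt) 2
    have h5 := h.norm_sub_sq_le (r.pt_mem (t + 1))
    -- The constant is `2s` (support) times `2²` (thresholding) times `2/α` (growth); against `32 s`
    -- it leaves the factor `1/2`.
    have h6 : l1Norm (xstar - r.hat (t + 1)) ^ 2 ≤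
        16 * s / α * (f (r.pt (t + 1)) - f xstar) := by
      calc _ ≤ (nnz (xstar - r.hat (t + 1)) : ℝ) * ‖xstar - r.hat (t + 1)‖ ^ 2 := h2
        _ ≤ 2 * s * (2 * ‖r.pt (t + 1) - xstar‖) ^ 2 := by gcongr
        _ = 8 * s * ‖r.pt (t + 1) - xstar‖ ^ 2 := by ring
        _ ≤ 8 * s * (2 / α * (f (r.pt (t + 1)) - f xstar)) := by gcongr
        _ = _ := by ring
    have h7 := h1.trans (mul_le_mul_of_nonneg_left h6 hα.le)
    have h8 : α * (16 * s / α * (f (r.pt (t + 1)) - f xstar)) =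
        16 * s * (f (r.pt (t + 1)) - f xstar) := by field_simp
    rw [h8] at h7
    have h9 : f (r.pt (t + 1 + 1)) - f xstar ≤ 1 / 2 * (f (r.pt (t + 1)) - f xstar) := by
      refine le_of_mul_le_mul_left ?_ hs0
      linarith
    have h10 : α * R ^ 2 / s * ((2 : ℝ) ^ (t + 1 + 3))⁻¹ =
        1 / 2 * (α * R ^ 2 / s * ((2 : ℝ) ^ (t + 3))⁻¹) := by
      rw [show t + 1 + 3 = (t + 3) + 1 by ring, pow_succ (2 : ℝ), mul_inv]; ring
    rw [h10]
    linarith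

/-- The number of epochs that suffices for accuracy `ε`. -/
def epochCount (s : ℕ) (R α ε : ℝ) : ℕ :=
  1 + ⌈Real.log (α * R ^ 2 / (s * ε)) / Real.log 2⌉₊

lemma epochCount_le (s : ℕ) (R α ε : ℝ) :
    (epochCount s R α ε : ℝ) ≤ 4 * max 1 (Real.log (α * R ^ 2 / (s * ε))) := by
  set L := Real.log (α * R ^ 2 / (s * ε)) with hL
  have h2 : 1 / 2 < Real.log 2 := by linarith [Real.log_two_gt_d9]
  have hm : 1 ≤ max 1 L := le_max_left _ _
  have h1 : L / Real.log 2 ≤ 2 * max 1 L := by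
    rw [div_le_iff₀ (by linarith)]
    have : max 1 L * (1 / 2) ≤ max 1 L * Real.log 2 :=
      mul_le_mul_of_nonneg_left h2.le (by linarith)
    linarith [le_max_right 1 L]
  -- The ceiling is taken of the nonnegative upper bound, since `L` itself may be negative.
  have h3 : (⌈L / Real.log 2⌉₊ : ℝ) ≤ 2 * max 1 L + 1 :=
    (Nat.cast_le.2 (Nat.ceil_mono h1)).trans (Nat.ceil_lt_add_one (by linarith)).le
  rw [epochCount, ← hL]
  push_cast
  linarith

lemma mul_two_pow_inv_le {ε : ℝ} (hs : 1 ≤ s) (hα : 0 < α) (hε : 0 < ε) {t : ℕ}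
    (ht : epochCount s R α ε ≤ t + 1) :
    α * R ^ 2 / s * ((2 : ℝ) ^ (t + 3))⁻¹ ≤ ε := by
  have hs0 : (0 : ℝ) < s := by exact_mod_cast hs
  -- For `R = 0` the argument of the logarithm is not positive, but the bound to prove is trivial.
  rcases eq_or_ne R 0 with rfl | hR
  · simpa using hε.le
  have hX : 0 < α * R ^ 2 / (s * ε) := by positivity
  have hl2 : 0 < Real.log 2 := Real.log_pos (by norm_num)
  have h1 : Real.log (α * R ^ 2 / (s * ε)) / Real.log 2 ≤ t :=
    Nat.ceil_le.1 (by rw [epochCount] at ht; omega)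
  rw [div_le_iff₀ hl2, ← Real.log_pow, Real.log_le_log_iff hX (by positivity),
    div_le_iff₀ (by positivity)] at h1
  have h2 : (2 : ℝ) ^ t ≤ 2 ^ (t + 3) := pow_le_pow_right₀ (by norm_num) (by omega)
  rw [← div_eq_mul_inv, div_le_iff₀ (by positivity), div_le_iff₀ hs0]
  calc α * R ^ 2 ≤ 2 ^ t * (s * ε) := h1
    _ ≤ 2 ^ (t + 3) * (s * ε) := by gcongr
    _ = _ := by ring

lemma ceil_epochBound_add_one_le (n s : ℕ) (α β : ℝ) :
    (⌈epochBound n s α β⌉₊ : ℝ) + 1 ≤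
      (8 * Real.exp 1 + 1) * max 1 (Real.sqrt (β * s * Real.log n / α)) := by
  have h1 : epochBound n s α β = 8 * Real.exp 1 * Real.sqrt (β * s * Real.log n / α) - 1 := by
    rw [epochBound, show 64 * s * β * Real.exp 1 ^ 2 * Real.log n / α =
      (8 * Real.exp 1) ^ 2 * (β * s * Real.log n / α) by ring, Real.sqrt_mul (sq_nonneg _),
      Real.sqrt_sq (by positivity)]
  set M := max 1 (Real.sqrt (β * s * Real.log n / α))
  have hM : 1 ≤ M := le_max_left _ _
  have he : 1 ≤ Real.exp 1 := Real.one_le_exp zero_le_one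
  have h2 : epochBound n s α β ≤ 8 * Real.exp 1 * M - 1 := by
    rw [h1]
    have := mul_le_mul_of_nonneg_left
      (le_max_right 1 (Real.sqrt (β * s * Real.log n / α)))
      (by positivity : 0 ≤ 8 * Real.exp 1)
    linarith
  have h3 : 1 ≤ Real.exp 1 * M := one_le_mul_of_one_le_of_one_le he hM
  have h4 : (⌈epochBound n s α β⌉₊ : ℝ) ≤ 8 * Real.exp 1 * M - 1 + 1 :=
    (Nat.cast_le.2 (Nat.ceil_mono h2)).trans (Nat.ceil_lt_add_one (by linarith)).le
  linarith

end Restart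

end SparseL1

end

theorem mainTheorem6 :
    (∀ (n s K : ℕ) (R α β : ℝ), 3 ≤ n → 1 ≤ s → s ≤ n → 0 < α → 0 ≤ β →
      SparseL1.epochBound n s α β ≤ (K : ℝ) →
      ∀ (f : SparseL1.Vec n → ℝ) (xstar : SparseL1.Vec n),
        SparseL1.IsProblem f R α β s xstar →
        ∀ (r : SparseL1.RestartRun f R β s K) (t : ℕ),
          f (r.pt (t + 1)) - f xstar ≤ α * R ^ 2 / s * ((2 : ℝ) ^ (t + 3))⁻¹) ∧
    (∃ C : ℝ, 0 < C ∧
      ∀ (n s K : ℕ) (R α β ε : ℝ), 3 ≤ n → 1 ≤ s → s ≤ n → 0 < α → 0 ≤ β → 0 < ε →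
        K = ⌈SparseL1.epochBound n s α β⌉₊ →
        ∃ T : ℕ, ∀ (f : SparseL1.Vec n → ℝ) (xstar : SparseL1.Vec n),
          SparseL1.IsProblem f R α β s xstar →
          ∀ r : SparseL1.RestartRun f R β s K,
            ((r.queries T).length : ℝ) ≤
              C * max 1 (Real.sqrt (β * s * Real.log n / α)) *
                max 1 (Real.log (α * R ^ 2 / (s * ε))) ∧
            ∀ t : ℕ, T ≤ t → f (r.pt t) - f xstar ≤ ε) := by
  -- `C` is the product of the constants in `epochCount_le` and `ceil_epochBound_add_one_le`.
  refine ⟨fun n s K R α β hn hs _ hα hβ hK f xstar h r t =>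
    r.sub_le hn hs hα hβ hK h t, 4 * (8 * Real.exp 1 + 1), by positivity, ?_⟩
  intro n s K R α β ε hn hs _ hα hβ hε hK
  refine ⟨SparseL1.epochCount s R α ε, fun f xstar h r => ⟨?_, fun t ht => ?_⟩⟩
  · have h1 := SparseL1.epochCount_le s R α ε
    have h2 := SparseL1.ceil_epochBound_add_one_le n s α β
    rw [← hK] at h2
    rw [r.length_queries]
    push_cast
    refine (mul_le_mul h1 h2 (by positivity) (by positivity)).trans (le_of_eq ?_)
    ring
  -- `epochCount` is at least 1, so the rate, which starts at `pt 1`, applies.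
  · obtain ⟨t, rfl⟩ : ∃ u, t = u + 1 :=
      Nat.exists_eq_add_one.2 (lt_of_lt_of_le (by simp [SparseL1.epochCount]) ht)
    exact (r.sub_le hn hs hα hβ (hK ▸ Nat.le_ceil _) h t).trans
      (SparseL1.mul_two_pow_inv_le hs hα hε ht)
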